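/- Let $\mathbb F$ be a field of characteristic $0$. A \emph{finite-dimensionally graded vertex algebra} is a $\mathbb Z$-graded vector space $V=\coprod_{k\in\mathbb Z}V_{(k)}$ over $\mathbb F$ with $\dim V_{(k)}<\infty$ for all $k$ and $V_{(k)}=0$ for $k\ll 0$, together with a vertex algebra structure $(V,Y,\mathbf 1)$, i.e. a linear map $Y(\cdot,x):V\to(\operatorname{End}V)[[x,x^{-1}]]$ and a vector $\mathbf 1\in V$ with $Y(u,x)v\in V((x))$, $Y(\mathbf 1,x)=\mathrm{Id}_V$, $Y(v,x)\mathbf 1\in V[[x]]$, $\lim_{x\to0}Y(v,x)\mathbf 1=v$, and the Jacobi identity $$x_0^{-1}\delta\Big(\tfrac{x_1-x_2}{x_0}\Big)Y(u,x_1)Y(v,x_2)-x_0^{-1}\delta\Big(\tfrac{x_2-x_1}{-x_0}\Big)Y(v,x_2)Y(u,x_1)=x_2^{-1}\delta\Big(\tfrac{x_1-x_0}{x_2}\Big)Y(Y(u,x_0)v,x_2),$$ such that, writing $Y(u,x)=\sum_n u_nx^{-n-1}$, one has $u_nv\in V_{(j+k-n-1)}$ for $u\in V_{(j)}$, $v\in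 V_{(k)}$. Here $\delta(x)=\sum_{n\in\mathbb Z}x^n$ and $(x_i-x_j)^n$ is expanded in nonnegative powers of $x_j$. Morphisms are degree-preserving linear maps $f$ with $f(\mathbf 1)=\mathbf 1$ and $f(Y(u,x)v)=Y(f(u),x)f(v)$. A \emph{finite-dimensionally graded vertex coalgebra} is a $\mathbb Z$-graded vector space $V$ with the same finiteness conditions, together with linear maps $\Delta(x)=\sum_k\Delta_kx^{-k-1}:V\to(V\otimes V)[[x,x^{-1}]]$ and $c:V\to\mathbb F$ such that, for all $v\in V$, $(c\otimes\mathrm{Id})\Delta(x)v=v$; $(\mathrm{Id}\otimes c)\Delta(x)v\in V[[x]]$ with limit $v$ as $x\to0$; $\Delta(x)v\in(V\otimes V)((x^{-1}))$; $$x_0^{-1}\delta\Big(\tfrac{x_1-x_2}{x_0}\Big)(\mathrm{Id}\otimes\Delta(x_2))\Delta(x_1)-x_0^{-1}\delta\Big(\tfrac{x_2-x_1}{-x_0}\Big)(T\otimes\mathrm{Id})(\mathrm{Id}\otimes\Delta(x_1))\Delta(x_2)=x_2^{-1}\delta\Big(\tfrac{x_1-x_0}{x_2}\Big)(\Delta(x_0)\otimes\mathrm{Id})\Delta(x_2),$$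 where $T(u\otimes v)=v\otimes u$; and $\Delta_k(v)\in(V\otimes V)_{(r+k+1)}$ for $v\in V_{(r)}$. Morphisms are degree-preserving linear maps $f$ with $c\circ f=c$ and $(f\otimes f)\Delta(x)=\Delta(x)f$. Then graded dualization is a contravariant equivalence between these two categories. That is, there is an equivalence from the opposite of the category of finite-dimensionally graded vertex algebras to the category of finite-dimensionally graded vertex coalgebras such that, naturally in the object: (i) it sends $(V,Y,\mathbf 1)$ to the graded dual $V'=\coprod_kV_{(k)}^*$ with the structure determined by $\langle\Delta(x)u',v\otimes w\rangle=\langle u',Y(v,x)w\rangle$ and $c(u')=\langle u',\mathbf 1\rangle$, and morphisms to their transposes; (ii) its quasi-inverse sends $(V,\Delta,c)$ to $V'$ with the structure determined by $\langle Y(f,x)g,w\rangle=\langle f\otimes g,\Delta(x)w\rangle$ and $\langle\mathbf 1,w\rangle=c(w)$, and morphisms to their transposes; (iii) the unit and counit of the equivalence are given by the canonical isomorphisms $V\cong V''$. -/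

import Mathlib

open CategoryTheory Opposite TensorProduct DirectSum

universe u v

namespace VertexDuality

noncomputable section

/-! ### Formal calculus

A formal series `∑ n ∈ ℤ, w_n x ^ n` in `W[[x, x⁻¹]]` is its coefficient function `ℤ → W`, `n ↦ w_n`
(the index is the exponent of `x`). -/

/-- The coefficient of `z ^ a * x ^ b * y ^ c` in
`z⁻¹ δ((x - y) / z) = ∑ n ∈ ℤ, z ^ (-n - 1) * (x - y) ^ n`,
where `(x - y) ^ n = ∑ i ≥ 0, (-1) ^ i * (n choose i) * x ^ (n - i) * y ^ i`. -/
def deltaCoeff (a b c : ℤ) : ℤ :=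
  if 0 ≤ c ∧ a + b + c = -1 then (-1) ^ c.toNat * Ring.choose (b + c) c.toNat else 0

/-- The coefficient of `z ^ a * x ^ b * y ^ c` in
`z⁻¹ δ((x - y) / (-z)) = ∑ n ∈ ℤ, (-1) ^ n * z ^ (-n - 1) * (x - y) ^ n`. -/
def deltaCoeffNeg (a b c : ℤ) : ℤ :=
  ((a + 1).negOnePow : ℤ) * deltaCoeff a b c

/-! ### Vertex algebras and vertex coalgebras -/

/-- A vertex algebra structure on the vector space `V`. `Y u n` is the coefficient of `x ^ n` in
`Y(u, x)`, that is, the mode `u_{-n-1}`. -/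
structure VertexAlgebra (F : Type u) (V : Type v) [Field F] [AddCommGroup V] [Module F V] where
  /-- The vertex operator map `V → (End V)[[x, x⁻¹]]`. -/
  Y : V →ₗ[F] (ℤ → Module.End F V)
  /-- The vacuum vector `𝟏`. -/
  vac : V
  /-- `Y(u, x) v ∈ V((x))`. -/
  truncation : ∀ u v : V, ∃ N : ℤ, ∀ n < N, Y u n v = 0
  /-- `Y(𝟏, x) v = v`. -/
  vacuum : ∀ (v : V) (n : ℤ), Y vac n v = if n = 0 then v else 0
  /-- `Y(v, x) 𝟏 ∈ V[[x]]`. -/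
  creation : ∀ (v : V), ∀ n < 0, Y v n vac = 0
  /-- `lim_{x → 0} Y(v, x) 𝟏 = v`. -/
  creation_zero : ∀ v : V, Y v 0 vac = v
  /-- The Jacobi identity: equality of the coefficients of `x₀ ^ a * x₁ ^ b * x₂ ^ c` in
  `x₀⁻¹ δ((x₁ - x₂) / x₀) Y(u, x₁) Y(v, x₂) w - x₀⁻¹ δ((x₂ - x₁) / (-x₀)) Y(v, x₂) Y(u, x₁) w`
  and `x₂⁻¹ δ((x₁ - x₀) / x₂) Y(Y(u, x₀) v, x₂) w`. The sums have finite support by truncation. -/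
  jacobi : ∀ (u v w : V) (a b c : ℤ),
    (∑ᶠ p : ℤ × ℤ, deltaCoeff a p.1 p.2 • Y u (b - p.1) (Y v (c - p.2) w))
      - (∑ᶠ p : ℤ × ℤ, deltaCoeffNeg a p.2 p.1 • Y v (c - p.2) (Y u (b - p.1) w))
      = ∑ᶠ p : ℤ × ℤ, deltaCoeff p.2 b p.1 • Y (Y u (a - p.1) v) (c - p.2) w

/-- A vertex coalgebra structure on the vector space `V`. `Y v n` is the coefficient of `x ^ n` in
the coproduct `Y(x) v`, that is, `Δ_{-n-1} v`. -/
structure VertexCoalgebra (F : Type u) (V : Type v) [Field F] [AddCommGroup V] [Module F V] where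
  /-- The coproduct `V → (V ⊗ V)[[x, x⁻¹]]`. -/
  Y : V →ₗ[F] (ℤ → V ⊗[F] V)
  /-- The covacuum map. -/
  c : V →ₗ[F] F
  /-- `(c ⊗ Id) Y(x) v = v`. -/
  counit : ∀ (v : V) (n : ℤ),
    TensorProduct.lid F V (c.rTensor V (Y v n)) = if n = 0 then v else 0
  /-- `(Id ⊗ c) Y(x) v ∈ V[[x]]`. -/
  cocreation : ∀ (v : V), ∀ n < 0, TensorProduct.rid F V (c.lTensor V (Y v n)) = 0
  /-- `lim_{x → 0} (Id ⊗ c) Y(x) v = v`. -/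
  cocreation_zero : ∀ v : V, TensorProduct.rid F V (c.lTensor V (Y v 0)) = v
  /-- `Y(x) v ∈ (V ⊗ V)((x⁻¹))`. -/
  truncation : ∀ v : V, ∃ N : ℤ, ∀ n > N, Y v n = 0
  /-- The Jacobi identity: equality of the coefficients of `x₀ ^ a * x₁ ^ b * x₂ ^ c'` in
  `x₀⁻¹ δ((x₁ - x₂) / x₀) (Id ⊗ Y(x₂)) Y(x₁) v
    - x₀⁻¹ δ((x₂ - x₁) / (-x₀)) (T ⊗ Id) (Id ⊗ Y(x₁)) Y(x₂) v`
  and `x₂⁻¹ δ((x₁ - x₀) / x₂) (Y(x₀) ⊗ Id) Y(x₂) v`, in `V ⊗ (V ⊗ V)`. The map `leftComm` is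
  `T ⊗ Id`. The sums have finite support by truncation. -/
  jacobi : ∀ (v : V) (a b c' : ℤ),
    (∑ᶠ p : ℤ × ℤ, deltaCoeff a p.1 p.2 •
        LinearMap.lTensor V (LinearMap.proj (c' - p.2) ∘ₗ Y) (Y v (b - p.1)))
      - (∑ᶠ p : ℤ × ℤ, deltaCoeffNeg a p.2 p.1 •
        TensorProduct.leftComm F V V V
          (LinearMap.lTensor V (LinearMap.proj (b - p.1) ∘ₗ Y) (Y v (c' - p.2))))
      = ∑ᶠ p : ℤ × ℤ, deltaCoeff p.2 b p.1 •
        TensorProduct.assoc F V V V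
          (LinearMap.rTensor V (LinearMap.proj (a - p.1) ∘ₗ Y) (Y v (c' - p.2)))

/-! ### Graded vector spaces and graded duals -/

/-- The category of `ℤ`-graded vector spaces and degree-preserving linear maps. -/
abbrev GrVect (F : Type u) [Field F] := GradedObject ℤ (ModuleCat.{v} F)

/-- The vector space `∐ k, V_(k)` underlying a graded vector space. -/
abbrev GrVect.Total {F : Type u} [Field F] (V : GrVect.{u, v} F) : Type v := ⨁ k, V k

/-- The linear map on total spaces given by a degree-preserving map. -/
abbrev GrVect.total {F : Type u} [Field F] {V W : GrVect.{u, v} F} (f : V ⟶ W) :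
    V.Total →ₗ[F] W.Total :=
  DirectSum.lmap fun k => (f k).hom

/-- The homogeneous subspace `V_(k)` of `∐ k, V_(k)`. -/
def GrVect.weight {F : Type u} [Field F] (V : GrVect.{u, v} F) (k : ℤ) : Submodule F V.Total :=
  LinearMap.range (DirectSum.lof F ℤ (fun k => V k) k)

/-- The homogeneous subspace `(V ⊗ V)_(k) = ∐_{i + j = k} V_(i) ⊗ V_(j)` of `V ⊗ V`. -/
def GrVect.tensorWeight {F : Type u} [Field F] (V : GrVect.{u, v} F) (k : ℤ) :
    Submodule F (V.Total ⊗[F] V.Total) :=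
  ⨆ i : ℤ, LinearMap.range (TensorProduct.map
    (DirectSum.lof F ℤ (fun k => V k) i) (DirectSum.lof F ℤ (fun k => V k) (k - i)))

/-- `V_(k) = 0` for `k` sufficiently small. -/
def GrVect.BoundedBelow {F : Type u} [Field F] (V : GrVect.{u, v} F) : Prop :=
  ∃ N : ℤ, ∀ k < N, Subsingleton (V k)

/-- The contravariant graded dual functor, `V' = ∐ k, Hom(V_(k), F)`, acting on morphisms by
transposition. -/
def gradedDual (F : Type u) [Field F] :
    (GrVect.{u, max u v} F)ᵒᵖ ⥤ GrVect.{u, max u v} F where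
  obj V := fun k => ModuleCat.of F (Module.Dual F (V.unop k))
  map f := fun k => ModuleCat.ofHom (f.unop k).hom.dualMap

/-- The canonical map `V ⟶ V''`, sending `v` to evaluation at `v`. -/
def toDoubleDual {F : Type u} [Field F] (V : GrVect.{u, max u v} F) :
    V ⟶ (gradedDual.{u, v} F).obj (op ((gradedDual.{u, v} F).obj (op V))) :=
  fun k => ModuleCat.ofHom (Module.Dual.eval F (V k))

/-- The natural pairing `⟨f, v⟩ = ∑ k, f_k (v_k)` of `V'` with `V`. -/
def pairing {F : Type u} [Field F] (V : GrVect.{u, max u v} F) :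
    ((gradedDual.{u, v} F).obj (op V)).Total →ₗ[F] Module.Dual F V.Total :=
  DirectSum.toModule F ℤ (Module.Dual F V.Total)
    fun k => (DirectSum.component F ℤ (fun k => V k) k).dualMap

/-- The natural pairing of `V' ⊗ V'` with `V ⊗ V`, `⟨f ⊗ g, v ⊗ w⟩ = ⟨f, v⟩ ⟨g, w⟩`. -/
def tensorPairing {F : Type u} [Field F] (V : GrVect.{u, max u v} F) :
    ((gradedDual.{u, v} F).obj (op V)).Total ⊗[F] ((gradedDual.{u, v} F).obj (op V)).Total
      →ₗ[F] Module.Dual F (V.Total ⊗[F] V.Total) :=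
  TensorProduct.dualDistrib F V.Total V.Total ∘ₗ TensorProduct.map (pairing V) (pairing V)

/-! ### The category of finite-dimensionally graded vertex algebras -/

/-- A finite-dimensionally graded vertex algebra. -/
structure FDGVertexAlgebra (F : Type u) [Field F] where
  /-- The underlying graded vector space. -/
  space : GrVect.{u, v} F
  /-- The vertex algebra structure on `∐ k, V_(k)`. -/
  str : VertexAlgebra F space.Total
  boundedBelow : space.BoundedBelow
  finite : ∀ k, FiniteDimensional F (space k)
  /-- `u_n w ∈ V_(j+k-n-1)` for `u ∈ V_(j)`, `w ∈ V_(k)`; the mode `u_n` is the coefficient of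
  `x ^ (-n-1)`. -/
  graded : ∀ (j k n : ℤ), ∀ u ∈ space.weight j, ∀ w ∈ space.weight k,
    str.Y u (-n - 1) w ∈ space.weight (j + k - n - 1)

/-- A morphism of graded vertex algebras: a degree-preserving linear map with
`f (Y(u, x) w) = Y(f u, x) (f w)` and `f 𝟏 = 𝟏`. -/
@[ext]
structure FDGVertexAlgebra.Hom {F : Type u} [Field F] (A B : FDGVertexAlgebra.{u, v} F) where
  /-- The underlying map of graded vector spaces. -/
  map : A.space ⟶ B.space
  map_Y : ∀ (u w : A.space.Total) (n : ℤ),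
    GrVect.total map (A.str.Y u n w)
      = B.str.Y (GrVect.total map u) n (GrVect.total map w)
  map_vac : GrVect.total map A.str.vac = B.str.vac

theorem GrVect.total_id {F : Type u} [Field F] (V : GrVect.{u, v} F) :
    GrVect.total (𝟙 V) = LinearMap.id := by
  ext k x : 2
  simp [GrVect.total]

theorem GrVect.total_comp {F : Type u} [Field F] {U V W : GrVect.{u, v} F}
    (f : U ⟶ V) (g : V ⟶ W) :
    GrVect.total (f ≫ g) = GrVect.total g ∘ₗ GrVect.total f := by
  ext k x : 2
  simp [GrVect.total, DirectSum.lmap_lof]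

instance FDGVertexAlgebra.category (F : Type u) [Field F] :
    Category (FDGVertexAlgebra.{u, v} F) where
  Hom := FDGVertexAlgebra.Hom
  id A :=
    { map := 𝟙 A.space
      map_Y := by simp [GrVect.total_id]
      map_vac := by simp [GrVect.total_id] }
  comp f g :=
    { map := f.map ≫ g.map
      map_Y := by simp [GrVect.total_comp, f.map_Y, g.map_Y]
      map_vac := by simp [GrVect.total_comp, f.map_vac, g.map_vac] }
  id_comp f := FDGVertexAlgebra.Hom.ext (Category.id_comp f.map)
  comp_id f := FDGVertexAlgebra.Hom.ext (Category.comp_id f.map)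
  assoc f g h := FDGVertexAlgebra.Hom.ext (Category.assoc f.map g.map h.map)

/-- The functor from graded vertex algebras to graded vector spaces. -/
def FDGVertexAlgebra.forget (F : Type u) [Field F] :
    FDGVertexAlgebra.{u, v} F ⥤ GrVect.{u, v} F where
  obj A := A.space
  map f := FDGVertexAlgebra.Hom.map f

/-! ### The category of finite-dimensionally graded vertex coalgebras -/

/-- A finite-dimensionally graded vertex coalgebra. -/
structure FDGVertexCoalgebra (F : Type u) [Field F] where
  /-- The underlying graded vector space. -/
  space : GrVect.{u, v} F
  /-- The vertex coalgebra structure on `∐ k, V_(k)`. -/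
  str : VertexCoalgebra F space.Total
  boundedBelow : space.BoundedBelow
  finite : ∀ k, FiniteDimensional F (space k)
  /-- `Δ_k w ∈ (V ⊗ V)_(r+k+1)` for `w ∈ V_(r)`; `Δ_k` is the coefficient of `x ^ (-k-1)`. -/
  graded : ∀ (r k : ℤ), ∀ w ∈ space.weight r,
    str.Y w (-k - 1) ∈ space.tensorWeight (r + k + 1)

/-- A morphism of graded vertex coalgebras: a degree-preserving linear map with
`(f ⊗ f) Y(x) w = Y(x) (f w)` and `c ∘ f = c`. -/
@[ext]
structure FDGVertexCoalgebra.Hom {F : Type u} [Field F] (C D : FDGVertexCoalgebra.{u, v} F) where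
  /-- The underlying map of graded vector spaces. -/
  map : C.space ⟶ D.space
  map_Y : ∀ (w : C.space.Total) (n : ℤ),
    TensorProduct.map (GrVect.total map) (GrVect.total map) (C.str.Y w n)
      = D.str.Y (GrVect.total map w) n
  map_c : ∀ w : C.space.Total, D.str.c (GrVect.total map w) = C.str.c w

instance FDGVertexCoalgebra.category (F : Type u) [Field F] :
    Category (FDGVertexCoalgebra.{u, v} F) where
  Hom := FDGVertexCoalgebra.Hom
  id C :=
    { map := 𝟙 C.space
      map_Y := by simp [GrVect.total_id]
      map_c := by simp [GrVect.total_id] }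
  comp f g :=
    { map := f.map ≫ g.map
      map_Y := by
        intro w n
        simp only [GrVect.total_comp, TensorProduct.map_comp, LinearMap.comp_apply, f.map_Y,
          g.map_Y]
      map_c := by simp [GrVect.total_comp, f.map_c, g.map_c] }
  id_comp f := FDGVertexCoalgebra.Hom.ext (Category.id_comp f.map)
  comp_id f := FDGVertexCoalgebra.Hom.ext (Category.comp_id f.map)
  assoc f g h := FDGVertexCoalgebra.Hom.ext (Category.assoc f.map g.map h.map)

/-- The functor from graded vertex coalgebras to graded vector spaces. -/
def FDGVertexCoalgebra.forget (F : Type u) [Field F] :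
    FDGVertexCoalgebra.{u, v} F ⥤ GrVect.{u, v} F where
  obj C := C.space
  map f := FDGVertexCoalgebra.Hom.map f

/-! ### Dual structures -/

/-- Under an identification `φ` of the graded space of `C` with the graded dual of that of `A`, the
coalgebra structure of `C` is the dual of the algebra structure of `A`:
`⟨Y(x) ξ, v ⊗ w⟩ = ⟨ξ, Y(v, x) w⟩` and `c(ξ) = ⟨ξ, 𝟏⟩`. -/
structure IsDualCoalgebra {F : Type u} [Field F] (A : FDGVertexAlgebra.{u, max u v} F)
    (C : FDGVertexCoalgebra.{u, max u v} F)
    (φ : C.space ≅ (gradedDual.{u, v} F).obj (op A.space)) : Prop where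
  coproduct : ∀ (ξ : C.space.Total) (v w : A.space.Total) (n : ℤ),
    tensorPairing A.space
        (TensorProduct.map (GrVect.total φ.hom) (GrVect.total φ.hom) (C.str.Y ξ n)) (v ⊗ₜ[F] w)
      = pairing A.space (GrVect.total φ.hom ξ) (A.str.Y v n w)
  covacuum : ∀ ξ : C.space.Total, C.str.c ξ = pairing A.space (GrVect.total φ.hom ξ) A.str.vac

/-- Under an identification `ψ` of the graded space of `A` with the graded dual of that of `C`, the
algebra structure of `A` is the dual of the coalgebra structure of `C`:
`⟨Y(f, x) g, w⟩ = ⟨f ⊗ g, Y(x) w⟩` and `⟨𝟏, w⟩ = c(w)`. -/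
structure IsDualAlgebra {F : Type u} [Field F] (C : FDGVertexCoalgebra.{u, max u v} F)
    (A : FDGVertexAlgebra.{u, max u v} F)
    (ψ : A.space ≅ (gradedDual.{u, v} F).obj (op C.space)) : Prop where
  product : ∀ (f g : A.space.Total) (w : C.space.Total) (n : ℤ),
    pairing C.space (GrVect.total ψ.hom (A.str.Y f n g)) w
      = tensorPairing C.space (GrVect.total ψ.hom f ⊗ₜ[F] GrVect.total ψ.hom g) (C.str.Y w n)
  vacuum : ∀ w : C.space.Total, pairing C.space (GrVect.total ψ.hom A.str.vac) w = C.str.c w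

end

end VertexDuality

/-!
Call linear maps `f : P → P'` and `g : Q' → Q` transposes of each other for pairings of `P` with `Q`
and of `P'` with `Q'` if `⟨f p, q⟩ = ⟨p, g q⟩`. If a product on `Q` and a coproduct on `P` are
transposes of each other, then evaluating an identity of vertex coalgebras in `P` against elements
of `Q` gives the corresponding identity of vertex algebras in `Q`, and conversely, so for
nondegenerate pairings the two sets of axioms are equivalent; likewise for the two notions of
morphism. It remains to produce transposes. A homogeneous map always has one between graded duals,
and since the grading is bounded below with finite-dimensional pieces, `(V ⊗ V)_(k)` is a finite sum
of finite-dimensional spaces, so the graded dual of `V ⊗ V` is `V' ⊗ V'`. The covacuum is an element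
of `V'` because it vanishes outside degree `0`: if `v` has degree `r`, so does the constant term of
`Y(x) v`, which is sent to `v` by both `Id ⊗ c` and `c ⊗ Id`; applying to it `c ⊗ c` after a
projection to degree `r` on the left, or equivalently to degree `0` on the right, gives `c(v)` in
the first form and `0` in the second if `r ≠ 0`. Finally `V` is its own double dual degree by
degree, and the required compatibilities of `V ≅ V''` already hold for graded vector spaces.
-/

namespace VertexDuality

noncomputable section

/-! ### Pairings and transposes -/

section AdjointPair

variable {R : Type*} [CommSemiring R]
  {P'' P' P : Type*} [AddCommMonoid P''] [Module R P''] [AddCommMonoid P'] [Module R P']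
  [AddCommMonoid P] [Module R P]
  {Q'' Q' Q : Type*} [AddCommMonoid Q''] [Module R Q''] [AddCommMonoid Q'] [Module R Q']
  [AddCommMonoid Q] [Module R Q]

/-- The tensor product of two pairings: `⟨p ⊗ p', q ⊗ q'⟩ = ⟨p, q⟩ ⟨p', q'⟩`. -/
def tmulPairing (B : P →ₗ[R] Module.Dual R Q) (B' : P' →ₗ[R] Module.Dual R Q') :
    P ⊗[R] P' →ₗ[R] Module.Dual R (Q ⊗[R] Q') :=
  TensorProduct.dualDistrib R Q Q' ∘ₗ TensorProduct.map B B'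

@[simp]
theorem tmulPairing_tmul (B : P →ₗ[R] Module.Dual R Q) (B' : P' →ₗ[R] Module.Dual R Q')
    (p : P) (p' : P') (q : Q) (q' : Q') :
    tmulPairing B B' (p ⊗ₜ p') (q ⊗ₜ q') = B p q * B' p' q' := rfl

theorem tmulPairing_flip (B : P →ₗ[R] Module.Dual R Q) (B' : P' →ₗ[R] Module.Dual R Q') :
    (tmulPairing B B').flip = tmulPairing B.flip B'.flip := by
  ext; simp

theorem dualDistrib_tmul_eq_apply_lid (f : Module.Dual R P) (f' : Module.Dual R P')
    (X : P ⊗[R] P') :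
    TensorProduct.dualDistrib R P P' (f ⊗ₜ f') X
      = f' (TensorProduct.lid R P' (f.rTensor P' X)) := by
  induction X with
  | zero => simp only [map_zero]
  | add X Z hX hZ => simp only [map_add, hX, hZ]
  | tmul p p' => simp

theorem dualDistrib_tmul_eq_apply_rid (f : Module.Dual R P) (f' : Module.Dual R P')
    (X : P ⊗[R] P') :
    TensorProduct.dualDistrib R P P' (f ⊗ₜ f') X
      = f (TensorProduct.rid R P (f'.lTensor P X)) := by
  induction X with
  | zero => simp only [map_zero]
  | add X Z hX hZ => simp only [map_add, hX, hZ]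
  | tmul p p' => simp [mul_comm]

theorem apply_lid_rTensor (B : P →ₗ[R] Module.Dual R Q) (B' : P' →ₗ[R] Module.Dual R Q')
    (X : P ⊗[R] P') (q : Q) (q' : Q') :
    B' (TensorProduct.lid R P' ((B.flip q).rTensor P' X)) q' = tmulPairing B B' X (q ⊗ₜ q') := by
  rw [← LinearMap.flip_apply (tmulPairing B B'), tmulPairing_flip]
  exact (dualDistrib_tmul_eq_apply_lid (B.flip q) (B'.flip q') X).symm

theorem apply_rid_lTensor (B : P →ₗ[R] Module.Dual R Q) (B' : P' →ₗ[R] Module.Dual R Q')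
    (X : P ⊗[R] P') (q : Q) (q' : Q') :
    B (TensorProduct.rid R P ((B'.flip q').lTensor P X)) q = tmulPairing B B' X (q ⊗ₜ q') := by
  rw [← LinearMap.flip_apply (tmulPairing B B'), tmulPairing_flip]
  exact (dualDistrib_tmul_eq_apply_rid (B.flip q) (B'.flip q') X).symm

theorem tmulPairing_injective [Module.Free R P'] {B : P →ₗ[R] Module.Dual R Q}
    {B' : P' →ₗ[R] Module.Dual R Q'} (hB : Function.Injective B) (hB' : Function.Injective B') :
    Function.Injective (tmulPairing B B') := by
  classical
  intro X Z hXZ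
  have contract_eq (q : Q) : TensorProduct.lid R P' ((B.flip q).rTensor P' X)
      = TensorProduct.lid R P' ((B.flip q).rTensor P' Z) :=
    hB' (LinearMap.ext fun q' => by simp only [apply_lid_rTensor, hXZ])
  let b := Module.Free.chooseBasis R P'
  have coord_eq (i) : TensorProduct.rid R P ((b.coord i).lTensor P X)
      = TensorProduct.rid R P ((b.coord i).lTensor P Z) :=
    hB <| LinearMap.ext fun q => by
      simp only [← LinearMap.flip_apply B, ← dualDistrib_tmul_eq_apply_rid,
        dualDistrib_tmul_eq_apply_lid, contract_eq]
  apply (TensorProduct.equivFinsuppOfBasisRight (M := P) b).injective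
  ext i
  simpa only [TensorProduct.equivFinsuppOfBasisRight_apply] using coord_eq i

/-- `f` and `g` are transposes of each other with respect to two pairings. Unlike in
`LinearMap.IsAdjointPair`, the two arguments of a pairing may belong to different modules. -/
def IsAdjointPair (B : P →ₗ[R] Module.Dual R Q) (B' : P' →ₗ[R] Module.Dual R Q')
    (f : P →ₗ[R] P') (g : Q' →ₗ[R] Q) : Prop :=
  ∀ p q, B' (f p) q = B p (g q)

variable {B : P →ₗ[R] Module.Dual R Q} {B' : P' →ₗ[R] Module.Dual R Q'}
  {B'' : P'' →ₗ[R] Module.Dual R Q''}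

theorem isAdjointPair_id (B : P →ₗ[R] Module.Dual R Q) :
    IsAdjointPair B B LinearMap.id LinearMap.id := fun _ _ => rfl

namespace IsAdjointPair

theorem comp {f : P →ₗ[R] P'} {g : Q' →ₗ[R] Q} {f' : P' →ₗ[R] P''} {g' : Q'' →ₗ[R] Q'}
    (h' : IsAdjointPair B' B'' f' g') (h : IsAdjointPair B B' f g) :
    IsAdjointPair B B'' (f' ∘ₗ f) (g ∘ₗ g') := fun p q =>
  (h' (f p) q).trans (h p (g' q))

theorem flip {f : P →ₗ[R] P'} {g : Q' →ₗ[R] Q} (h : IsAdjointPair B B' f g) :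
    IsAdjointPair B'.flip B.flip g f := fun q p => (h p q).symm

theorem left_unique {f f' : P →ₗ[R] P'} {g : Q' →ₗ[R] Q} (hB' : Function.Injective B')
    (h : IsAdjointPair B B' f g) (h' : IsAdjointPair B B' f' g) : f = f' :=
  LinearMap.ext fun p => hB' (LinearMap.ext fun q => (h p q).trans (h' p q).symm)

theorem tmul {P₂ P₂' Q₂ Q₂' : Type*} [AddCommMonoid P₂] [Module R P₂] [AddCommMonoid P₂']
    [Module R P₂'] [AddCommMonoid Q₂] [Module R Q₂] [AddCommMonoid Q₂'] [Module R Q₂']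
    {B₂ : P₂ →ₗ[R] Module.Dual R Q₂} {B₂' : P₂' →ₗ[R] Module.Dual R Q₂'}
    {f : P →ₗ[R] P'} {g : Q' →ₗ[R] Q} {f₂ : P₂ →ₗ[R] P₂'} {g₂ : Q₂' →ₗ[R] Q₂}
    (h : IsAdjointPair B B' f g) (h₂ : IsAdjointPair B₂ B₂' f₂ g₂) :
    IsAdjointPair (tmulPairing B B₂) (tmulPairing B' B₂') (TensorProduct.map f f₂)
      (TensorProduct.map g g₂) := by
  have : tmulPairing B' B₂' ∘ₗ TensorProduct.map f f₂
      = (TensorProduct.map g g₂).dualMap ∘ₗ tmulPairing B B₂ := by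
    ext p p₂ q q₂
    simp [h p q, h₂ p₂ q₂]
  exact fun X Z => LinearMap.congr_fun (LinearMap.congr_fun this X) Z

end IsAdjointPair

theorem isAdjointPair_leftComm (B : P →ₗ[R] Module.Dual R Q) (B' : P' →ₗ[R] Module.Dual R Q')
    (B'' : P'' →ₗ[R] Module.Dual R Q'') :
    IsAdjointPair (tmulPairing B (tmulPairing B' B'')) (tmulPairing B' (tmulPairing B B''))
      (TensorProduct.leftComm R P P' P'').toLinearMap
      (TensorProduct.leftComm R Q' Q Q'').toLinearMap := by
  have : tmulPairing B' (tmulPairing B B'') ∘ₗ (TensorProduct.leftComm R P P' P'').toLinearMap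
      = (TensorProduct.leftComm R Q' Q Q'').toLinearMap.dualMap
        ∘ₗ tmulPairing B (tmulPairing B' B'') := by
    ext
    simp [mul_left_comm]
  exact fun X Z => LinearMap.congr_fun (LinearMap.congr_fun this X) Z

theorem isAdjointPair_assoc (B : P →ₗ[R] Module.Dual R Q) (B' : P' →ₗ[R] Module.Dual R Q')
    (B'' : P'' →ₗ[R] Module.Dual R Q'') :
    IsAdjointPair (tmulPairing (tmulPairing B B') B'') (tmulPairing B (tmulPairing B' B''))
      (TensorProduct.assoc R P P' P'').toLinearMap
      (TensorProduct.assoc R Q Q' Q'').symm.toLinearMap := by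
  have : tmulPairing B (tmulPairing B' B'') ∘ₗ (TensorProduct.assoc R P P' P'').toLinearMap
      = (TensorProduct.assoc R Q Q' Q'').symm.toLinearMap.dualMap
        ∘ₗ tmulPairing (tmulPairing B B') B'' := by
    ext
    simp [mul_assoc]
  exact fun X Z => LinearMap.congr_fun (LinearMap.congr_fun this X) Z

end AdjointPair

/-! ### The Jacobi identity under transposition -/

section Jacobi

theorem finite_support_smul_of_mem_Icc {M : Type*} [AddCommGroup M] {κ : ℤ × ℤ → ℤ}
    {G : ℤ × ℤ → M} {s l m : ℤ}
    (h : ∀ i j, κ (i, j) ≠ 0 → G (i, j) ≠ 0 → i + j = s ∧ l ≤ j ∧ j ≤ m) :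
    (Function.support fun p => κ p • G p).Finite := by
  refine ((Set.finite_Icc l m).image fun j => (s - j, j)).subset ?_
  rintro ⟨i, j⟩ hij
  obtain ⟨rfl, hj⟩ := h i j (fun hκ => hij (by simp [hκ])) (fun hG => hij (by simp [hG]))
  exact ⟨j, hj, by simp⟩

theorem deltaCoeff_ne_zero {a b c : ℤ} (h : deltaCoeff a b c ≠ 0) : 0 ≤ c ∧ a + b + c = -1 := by
  by_contra hn
  exact h (if_neg hn)

theorem deltaCoeffNeg_ne_zero {a b c : ℤ} (h : deltaCoeffNeg a b c ≠ 0) :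
    0 ≤ c ∧ a + b + c = -1 :=
  deltaCoeff_ne_zero (right_ne_zero_of_mul h)

theorem apply_finsum_smul_eq {R M N : Type*} [CommRing R] [AddCommGroup M] [Module R M]
    [AddCommGroup N] [Module R N] {ι : Type*} {κ : ι → ℤ} {G : ι → M} {H : ι → N}
    (f : Module.Dual R M) (g : Module.Dual R N)
    (hG : (Function.support fun i => κ i • G i).Finite)
    (hH : (Function.support fun i => κ i • H i).Finite) (h : ∀ i, f (G i) = g (H i)) :
    f (∑ᶠ i, κ i • G i) = g (∑ᶠ i, κ i • H i) := by
  rw [← LinearMap.toAddMonoidHom_coe f, ← LinearMap.toAddMonoidHom_coe g,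
    AddMonoidHom.map_finsum _ hG, AddMonoidHom.map_finsum _ hH]
  simp only [LinearMap.toAddMonoidHom_coe, map_zsmul, h]

variable {R : Type*} [CommRing R] {P Q : Type*} [AddCommGroup P] [Module R P]
  [AddCommGroup Q] [Module R Q]

/-- The coefficient of `x₀ ^ a * x₁ ^ b * x₂ ^ c` in the left-hand side of the Jacobi identity of a
vertex algebra. -/
def jacobiLeft (Y : Q →ₗ[R] (ℤ → Module.End R Q)) (u v w : Q) (a b c : ℤ) : Q :=
  (∑ᶠ p : ℤ × ℤ, deltaCoeff a p.1 p.2 • Y u (b - p.1) (Y v (c - p.2) w))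
    - (∑ᶠ p : ℤ × ℤ, deltaCoeffNeg a p.2 p.1 • Y v (c - p.2) (Y u (b - p.1) w))

/-- The coefficient of `x₀ ^ a * x₁ ^ b * x₂ ^ c` in the right-hand side of the Jacobi identity of a
vertex algebra. -/
def jacobiRight (Y : Q →ₗ[R] (ℤ → Module.End R Q)) (u v w : Q) (a b c : ℤ) : Q :=
  ∑ᶠ p : ℤ × ℤ, deltaCoeff p.2 b p.1 • Y (Y u (a - p.1) v) (c - p.2) w

/-- The coefficient of `x₀ ^ a * x₁ ^ b * x₂ ^ c` in the left-hand side of the Jacobi identity of a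
vertex coalgebra. -/
def cojacobiLeft (D : P →ₗ[R] (ℤ → P ⊗[R] P)) (p : P) (a b c : ℤ) : P ⊗[R] (P ⊗[R] P) :=
  (∑ᶠ i : ℤ × ℤ, deltaCoeff a i.1 i.2 •
      LinearMap.lTensor P (LinearMap.proj (c - i.2) ∘ₗ D) (D p (b - i.1)))
    - (∑ᶠ i : ℤ × ℤ, deltaCoeffNeg a i.2 i.1 •
      TensorProduct.leftComm R P P P
        (LinearMap.lTensor P (LinearMap.proj (b - i.1) ∘ₗ D) (D p (c - i.2))))

/-- The coefficient of `x₀ ^ a * x₁ ^ b * x₂ ^ c` in the right-hand side of the Jacobi identity of a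
vertex coalgebra. -/
def cojacobiRight (D : P →ₗ[R] (ℤ → P ⊗[R] P)) (p : P) (a b c : ℤ) : P ⊗[R] (P ⊗[R] P) :=
  ∑ᶠ i : ℤ × ℤ, deltaCoeff i.2 b i.1 •
    TensorProduct.assoc R P P P
      (LinearMap.rTensor P (LinearMap.proj (a - i.1) ∘ₗ D) (D p (c - i.2)))

/-- The product `q ⊗ q' ↦ Y(q, x) q'` and the coproduct `D` are coefficientwise transposes of each
other. -/
def AreTransposeOperations (B : P →ₗ[R] Module.Dual R Q) (D : P →ₗ[R] (ℤ → P ⊗[R] P))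
    (Y : Q →ₗ[R] (ℤ → Module.End R Q)) : Prop :=
  ∀ n, IsAdjointPair B (tmulPairing B B) (LinearMap.proj n ∘ₗ D)
    (TensorProduct.lift (LinearMap.proj n ∘ₗ Y))

variable {B : P →ₗ[R] Module.Dual R Q} {D : P →ₗ[R] (ℤ → P ⊗[R] P)}
  {Y : Q →ₗ[R] (ℤ → Module.End R Q)}

namespace AreTransposeOperations

variable (h : AreTransposeOperations B D Y)

include h

theorem tmulPairing_apply (p : P) (q q' : Q) (n : ℤ) :
    tmulPairing B B (D p n) (q ⊗ₜ q') = B p (Y q n q') :=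
  h n p (q ⊗ₜ q')

theorem tmulPairing_lTensor (p : P) (u v w : Q) (m n : ℤ) :
    tmulPairing B (tmulPairing B B) (LinearMap.lTensor P (LinearMap.proj m ∘ₗ D) (D p n))
        (u ⊗ₜ (v ⊗ₜ w))
      = B p (Y u n (Y v m w)) :=
  ((isAdjointPair_id B).tmul (h m)).comp (h n) p (u ⊗ₜ (v ⊗ₜ w))

theorem tmulPairing_leftComm_lTensor (p : P) (u v w : Q) (m n : ℤ) :
    tmulPairing B (tmulPairing B B)
        (TensorProduct.leftComm R P P P
          (LinearMap.lTensor P (LinearMap.proj m ∘ₗ D) (D p n))) (u ⊗ₜ (v ⊗ₜ w))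
      = B p (Y v n (Y u m w)) :=
  ((isAdjointPair_leftComm B B B).comp (((isAdjointPair_id B).tmul (h m)).comp (h n)))
    p (u ⊗ₜ (v ⊗ₜ w))

theorem tmulPairing_assoc_rTensor (p : P) (u v w : Q) (m n : ℤ) :
    tmulPairing B (tmulPairing B B)
        (TensorProduct.assoc R P P P
          (LinearMap.rTensor P (LinearMap.proj m ∘ₗ D) (D p n))) (u ⊗ₜ (v ⊗ₜ w))
      = B p (Y (Y u m v) n w) :=
  ((isAdjointPair_assoc B B B).comp (((h m).tmul (isAdjointPair_id B)).comp (h n)))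
    p (u ⊗ₜ (v ⊗ₜ w))

variable (hD : ∀ p, ∃ N : ℤ, ∀ n > N, D p n = 0) (hY : ∀ u v, ∃ N : ℤ, ∀ n < N, Y u n v = 0)

include hD hY

theorem tmulPairing_cojacobiLeft (p : P) (u v w : Q) (a b c : ℤ) :
    tmulPairing B (tmulPairing B B) (cojacobiLeft D p a b c) (u ⊗ₜ (v ⊗ₜ w))
      = B p (jacobiLeft Y u v w a b c) := by
  obtain ⟨N, hN⟩ := hD p
  obtain ⟨Nvw, hvw⟩ := hY v w
  obtain ⟨Nuw, huw⟩ := hY u w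
  rw [← LinearMap.flip_apply, cojacobiLeft, jacobiLeft, map_sub, map_sub]
  congr 1
  · refine apply_finsum_smul_eq _ _
      (finite_support_smul_of_mem_Icc (s := -1 - a) (l := 0) (m := N - b - 1 - a)
        fun i j hκ hG => ?_)
      (finite_support_smul_of_mem_Icc (s := -1 - a) (l := 0) (m := c - Nvw)
        fun i j hκ hG => ?_)
      fun i => h.tmulPairing_lTensor p u v w _ _
    · have := deltaCoeff_ne_zero hκ
      have : b - i ≤ N := by
        by_contra! hi
        exact hG (by simp only [hN _ hi, map_zero])
      lia
    · have := deltaCoeff_ne_zero hκ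
      have : Nvw ≤ c - j := by
        by_contra! hj
        exact hG (by simp only [hvw _ hj, map_zero])
      lia
  · refine apply_finsum_smul_eq _ _
      (finite_support_smul_of_mem_Icc (s := -1 - a) (l := c - N) (m := -1 - a)
        fun i j hκ hG => ?_)
      (finite_support_smul_of_mem_Icc (s := -1 - a) (l := -1 - a - b + Nuw) (m := -1 - a)
        fun i j hκ hG => ?_)
      fun i => h.tmulPairing_leftComm_lTensor p u v w _ _
    · have := deltaCoeffNeg_ne_zero hκ
      have : c - j ≤ N := by
        by_contra! hj
        exact hG (by simp only [hN _ hj, map_zero])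
      lia
    · have := deltaCoeffNeg_ne_zero hκ
      have : Nuw ≤ b - i := by
        by_contra! hi
        exact hG (by simp only [huw _ hi, map_zero])
      lia

theorem tmulPairing_cojacobiRight (p : P) (u v w : Q) (a b c : ℤ) :
    tmulPairing B (tmulPairing B B) (cojacobiRight D p a b c) (u ⊗ₜ (v ⊗ₜ w))
      = B p (jacobiRight Y u v w a b c) := by
  obtain ⟨N, hN⟩ := hD p
  obtain ⟨Nuv, huv⟩ := hY u v
  rw [← LinearMap.flip_apply, cojacobiRight, jacobiRight]
  refine apply_finsum_smul_eq _ _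
    (finite_support_smul_of_mem_Icc (s := -1 - b) (l := c - N) (m := -1 - b)
      fun i j hκ hG => ?_)
    (finite_support_smul_of_mem_Icc (s := -1 - b) (l := -1 - b - a + Nuv) (m := -1 - b)
      fun i j hκ hG => ?_)
    fun i => h.tmulPairing_assoc_rTensor p u v w _ _
  · have := deltaCoeff_ne_zero hκ
    have : c - j ≤ N := by
      by_contra! hj
      exact hG (by simp only [hN _ hj, map_zero])
    lia
  · have := deltaCoeff_ne_zero hκ
    have : Nuv ≤ a - i := by
      by_contra! hi
      exact hG (by simp only [huv _ hi, map_zero, LinearMap.zero_apply, Pi.zero_apply])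
    lia

omit h hD hY

section Naturality

variable {P' Q' : Type*} [AddCommGroup P'] [Module R P'] [AddCommGroup Q'] [Module R Q']
  {B' : P' →ₗ[R] Module.Dual R Q'} {D' : P' →ₗ[R] (ℤ → P' ⊗[R] P')}
  {Y' : Q' →ₗ[R] (ℤ → Module.End R Q')}
  (h : AreTransposeOperations B D Y) (h' : AreTransposeOperations B' D' Y')
  {f : P' →ₗ[R] P} {g : Q →ₗ[R] Q'} (hfg : IsAdjointPair B' B f g)

include h h' hfg

theorem map_coproduct [Module.Free R P] (hB : Function.Injective B)
    (hg : ∀ u w n, g (Y u n w) = Y' (g u) n (g w)) (p : P') (n : ℤ) :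
    TensorProduct.map f f (D' p n) = D (f p) n := by
  have hYg : TensorProduct.lift (LinearMap.proj n ∘ₗ Y') ∘ₗ TensorProduct.map g g
      = g ∘ₗ TensorProduct.lift (LinearMap.proj n ∘ₗ Y) :=
    TensorProduct.ext' fun u w => (hg u w n).symm
  exact LinearMap.congr_fun (((hfg.tmul hfg).comp (h' n)).left_unique
    (tmulPairing_injective hB hB) (hYg ▸ (h n).comp hfg)) p

theorem map_product (hB' : Function.Injective B'.flip)
    (hf : ∀ p n, TensorProduct.map f f (D' p n) = D (f p) n) (u w : Q) (n : ℤ) :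
    g (Y u n w) = Y' (g u) n (g w) :=
  hB' <| LinearMap.ext fun p => by
    rw [LinearMap.flip_apply, LinearMap.flip_apply, ← hfg, ← h.tmulPairing_apply, ← hf,
      ← h'.tmulPairing_apply]
    exact (hfg.tmul hfg) (D' p n) (u ⊗ₜ w)

end Naturality

end AreTransposeOperations

end Jacobi

section OfTranspose

variable {F : Type*} [Field F] {P Q : Type*} [AddCommGroup P] [Module F P]
  [AddCommGroup Q] [Module F Q] {B : P →ₗ[F] Module.Dual F Q} {D : P →ₗ[F] (ℤ → P ⊗[F] P)}
  {Y : Q →ₗ[F] (ℤ → Module.End F Q)}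

/-- The vertex coalgebra whose coproduct is the transpose of the product of a vertex algebra. -/
def VertexCoalgebra.ofTranspose (𝒜 : VertexAlgebra F Q) (hB : Function.Injective B)
    (h : AreTransposeOperations B D 𝒜.Y) (hD : ∀ p, ∃ N : ℤ, ∀ n > N, D p n = 0) :
    VertexCoalgebra F P where
  Y := D
  c := B.flip 𝒜.vac
  counit p n := hB <| LinearMap.ext fun q => by
    rw [apply_lid_rTensor, h.tmulPairing_apply, 𝒜.vacuum]
    split_ifs <;> simp
  cocreation p n hn := hB <| LinearMap.ext fun q => by
    rw [apply_rid_lTensor, h.tmulPairing_apply, 𝒜.creation q n hn, map_zero, map_zero,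
      LinearMap.zero_apply]
  cocreation_zero p := hB <| LinearMap.ext fun q => by
    rw [apply_rid_lTensor, h.tmulPairing_apply, 𝒜.creation_zero]
  truncation := hD
  jacobi p a b c := tmulPairing_injective hB (tmulPairing_injective hB hB) <|
    TensorProduct.ext_threefold' fun u v w =>
      (h.tmulPairing_cojacobiLeft hD 𝒜.truncation p u v w a b c).trans <|
        (congrArg (B p) (𝒜.jacobi u v w a b c)).trans
          (h.tmulPairing_cojacobiRight hD 𝒜.truncation p u v w a b c).symm

/-- The vertex algebra whose product is the transpose of the coproduct of a vertex coalgebra. -/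
def VertexAlgebra.ofTranspose (𝒞 : VertexCoalgebra F P) (hB : Function.Injective B.flip)
    (h : AreTransposeOperations B 𝒞.Y Y) (hY : ∀ u v, ∃ N : ℤ, ∀ n < N, Y u n v = 0)
    (vac : Q) (hvac : B.flip vac = 𝒞.c) : VertexAlgebra F Q where
  Y := Y
  vac := vac
  truncation := hY
  vacuum q n := hB <| LinearMap.ext fun p => by
    rw [LinearMap.flip_apply, ← h.tmulPairing_apply, ← apply_lid_rTensor, hvac, 𝒞.counit]
    split_ifs <;> simp
  creation q n hn := hB <| LinearMap.ext fun p => by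
    rw [LinearMap.flip_apply, ← h.tmulPairing_apply, ← apply_rid_lTensor, hvac,
      𝒞.cocreation p n hn, map_zero, map_zero, LinearMap.zero_apply, LinearMap.zero_apply]
  creation_zero q := hB <| LinearMap.ext fun p => by
    rw [LinearMap.flip_apply, ← h.tmulPairing_apply, ← apply_rid_lTensor, hvac,
      𝒞.cocreation_zero, LinearMap.flip_apply]
  jacobi u v w a b c := hB <| LinearMap.ext fun p =>
    (h.tmulPairing_cojacobiLeft 𝒞.truncation hY p u v w a b c).symm.trans <|
      (congrArg (fun X => tmulPairing B (tmulPairing B B) X (u ⊗ₜ (v ⊗ₜ w)))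
        (𝒞.jacobi p a b c)).trans (h.tmulPairing_cojacobiRight 𝒞.truncation hY p u v w a b c)

end OfTranspose

/-! ### Graded dual pairings -/

section GradedDualPairing

variable {ι R : Type*} [CommRing R]
  {P' P Q' Q : Type*} [AddCommGroup P'] [Module R P'] [AddCommGroup P] [Module R P]
  [AddCommGroup Q'] [Module R Q'] [AddCommGroup Q] [Module R Q]

/-- The pairing `B` identifies `P`, spanned by the homogeneous subspaces `𝒰 k`, with the graded dual
of `Q`, spanned by the homogeneous subspaces `𝒲 k`. -/
structure IsGradedDualPairing (B : P →ₗ[R] Module.Dual R Q) (𝒰 : ι → Submodule R P)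
    (𝒲 : ι → Submodule R Q) : Prop where
  injective : Function.Injective B
  iSup_eq_top : ⨆ k, 𝒰 k = ⊤
  orthogonal : ∀ ⦃j k⦄, j ≠ k → ∀ p ∈ 𝒰 j, ∀ q ∈ 𝒲 k, B p q = 0
  exists_apply_eq : ∀ k (φ : Module.Dual R Q), (∀ j ≠ k, ∀ q ∈ 𝒲 j, φ q = 0) → ∃ p ∈ 𝒰 k, B p = φ

variable [AddGroup ι]

namespace IsGradedDualPairing

variable {B : P →ₗ[R] Module.Dual R Q} {B' : P' →ₗ[R] Module.Dual R Q'}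
  {𝒰 : ι → Submodule R P} {𝒲 : ι → Submodule R Q} {𝒰' : ι → Submodule R P'}
  {𝒲' : ι → Submodule R Q'}
  (hB : IsGradedDualPairing B 𝒰 𝒲) (hB' : IsGradedDualPairing B' 𝒰' 𝒲')
  {g : Q' →ₗ[R] Q} {d : ι} (hg : ∀ k, ∀ q ∈ 𝒲' k, g q ∈ 𝒲 (k + d))

include hB hB' hg

theorem exists_mem_apply_eq_comp {r : ι} {p : P} (hp : p ∈ 𝒰 r) :
    ∃ p' ∈ 𝒰' (r - d), B' p' = B p ∘ₗ g :=
  hB'.exists_apply_eq _ _ fun k hk q hq =>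
    hB.orthogonal (fun h => hk (eq_sub_of_add_eq h.symm)) p hp _ (hg k q hq)

theorem dualMap_apply_mem_range (p : P) : (g.dualMap ∘ₗ B) p ∈ LinearMap.range B' := by
  have : ⨆ r, 𝒰 r ≤ (LinearMap.range B').comap (g.dualMap ∘ₗ B) := iSup_le fun r p hp => by
    obtain ⟨p', -, h⟩ := hB.exists_mem_apply_eq_comp hB' hg hp
    exact ⟨p', h⟩
  exact this (hB.iSup_eq_top ▸ Submodule.mem_top)

/-- The transpose of a homogeneous linear map of degree `d`, as a map of graded duals. -/
def transpose : P →ₗ[R] P' :=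
  LinearMap.codRestrictOfInjective (g.dualMap ∘ₗ B) B' hB'.injective
    (hB.dualMap_apply_mem_range hB' hg)

theorem isAdjointPair_transpose : IsAdjointPair B B' (hB.transpose hB' hg) g := fun p q =>
  LinearMap.congr_fun (LinearMap.codRestrictOfInjective_comp_apply (g.dualMap ∘ₗ B) B'
    hB'.injective (hB.dualMap_apply_mem_range hB' hg) p) q

theorem transpose_mem {r : ι} {p : P} (hp : p ∈ 𝒰 r) :
    hB.transpose hB' hg p ∈ 𝒰' (r - d) := by
  obtain ⟨p', hp', h⟩ := hB.exists_mem_apply_eq_comp hB' hg hp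
  have : hB.transpose hB' hg p = p' := hB'.injective <| LinearMap.ext fun q =>
    (hB.isAdjointPair_transpose hB' hg p q).trans (LinearMap.congr_fun h q).symm
  exact this ▸ hp'

end IsGradedDualPairing

theorem exists_forall_gt_apply_eq_zero {𝒰 : ℤ → Submodule R P} {𝒰' : ℤ → Submodule R P'}
    (h𝒰 : ⨆ k, 𝒰 k = ⊤) {N : ℤ} (h𝒰' : ∀ k < N, 𝒰' k = ⊥) {T : ℤ → P →ₗ[R] P'}
    (hT : ∀ n r, ∀ p ∈ 𝒰 r, T n p ∈ 𝒰' (r - n)) (p : P) : ∃ M : ℤ, ∀ n > M, T n p = 0 := by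
  induction (h𝒰 ▸ Submodule.mem_top : p ∈ ⨆ k, 𝒰 k) using Submodule.iSup_induction' with
  | mem r p hp =>
    refine ⟨r - N, fun n hn => ?_⟩
    simpa only [h𝒰' (r - n) (by lia), Submodule.mem_bot] using hT n r p hp
  | zero => exact ⟨0, fun n _ => map_zero _⟩
  | add p q _ _ hp hq =>
    obtain ⟨M, hM⟩ := hp
    obtain ⟨M', hM'⟩ := hq
    refine ⟨max M M', fun n hn => ?_⟩
    rw [map_add, hM n (by lia), hM' n (by lia), add_zero]

end GradedDualPairing

/-! ### Graded vector spaces -/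

section GradedSpace

variable {F : Type u} [Field F] (V : GrVect.{u, v} F)

/-- The projection of `∐ k, V_(k)` onto `V_(k)`, as an endomorphism. -/
def GrVect.proj (k : ℤ) : Module.End F V.Total :=
  DirectSum.lof F ℤ (fun k => V k) k ∘ₗ DirectSum.component F ℤ (fun k => V k) k

variable {V}

theorem GrVect.proj_of_mem {k : ℤ} {x : V.Total} (hx : x ∈ V.weight k) : V.proj k x = x := by
  obtain ⟨x, rfl⟩ := hx
  rw [GrVect.proj, LinearMap.comp_apply, DirectSum.component.lof_self]

theorem GrVect.proj_of_mem_ne {j k : ℤ} (hjk : j ≠ k) {x : V.Total} (hx : x ∈ V.weight j) :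
    V.proj k x = 0 := by
  obtain ⟨x, rfl⟩ := hx
  rw [GrVect.proj, LinearMap.comp_apply, DirectSum.component.of, dif_neg hjk, map_zero]

theorem GrVect.iSup_weight : ⨆ k, V.weight k = ⊤ := DFinsupp.iSup_range_lsingle

theorem GrVect.weight_eq_bot (k : ℤ) [Subsingleton (V k)] : V.weight k = ⊥ :=
  LinearMap.range_eq_bot.2 (Subsingleton.elim _ _)

theorem GrVect.tensorWeight_le_iff {k : ℤ} {S : Submodule F (V.Total ⊗[F] V.Total)} :
    V.tensorWeight k ≤ S ↔
      ∀ i j, i + j = k → ∀ x ∈ V.weight i, ∀ y ∈ V.weight j, x ⊗ₜ y ∈ S := by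
  refine ⟨fun h i j hij x hx y hy => h ?_, fun h => iSup_le fun i => ?_⟩
  · obtain ⟨x, rfl⟩ := hx
    obtain ⟨y, rfl⟩ := hy
    obtain rfl : j = k - i := by lia
    exact le_iSup (fun i => LinearMap.range (TensorProduct.map
      (DirectSum.lof F ℤ (fun k => V k) i) (DirectSum.lof F ℤ (fun k => V k) (k - i)))) i
      ⟨x ⊗ₜ y, rfl⟩
  · rw [TensorProduct.range_map_eq_span_tmul, Submodule.span_le]
    rintro - ⟨x, y, rfl⟩
    exact h i (k - i) (by lia) _ ⟨x, rfl⟩ _ ⟨y, rfl⟩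

theorem GrVect.tmul_mem_tensorWeight {i j k : ℤ} (hij : i + j = k) {x y : V.Total}
    (hx : x ∈ V.weight i) (hy : y ∈ V.weight j) : x ⊗ₜ y ∈ V.tensorWeight k :=
  GrVect.tensorWeight_le_iff.1 le_rfl i j hij x hx y hy

theorem GrVect.tensorWeight_eq_bot {N k : ℤ} (hN : ∀ k < N, Subsingleton (V k))
    (hk : k < N + N) : V.tensorWeight k = ⊥ := by
  rw [eq_bot_iff, GrVect.tensorWeight_le_iff]
  intro i j hij x hx y hy
  rcases (by lia : i < N ∨ j < N) with hi | hj
  · have := hN i hi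
    rw [V.weight_eq_bot, Submodule.mem_bot] at hx
    simp [hx]
  · have := hN j hj
    rw [V.weight_eq_bot, Submodule.mem_bot] at hy
    simp [hy]

theorem GrVect.tensor_hom_ext {M : Type*} [AddCommGroup M] [Module F M]
    {f g : V.Total ⊗[F] V.Total →ₗ[F] M}
    (h : ∀ i j, ∀ x ∈ V.weight i, ∀ y ∈ V.weight j, f (x ⊗ₜ y) = g (x ⊗ₜ y)) : f = g := by
  ext i x j y
  exact h i j _ ⟨x, rfl⟩ _ ⟨y, rfl⟩

theorem GrVect.iSup_tensorWeight : ⨆ k, V.tensorWeight k = ⊤ := by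
  rw [← Submodule.ker_mkQ (⨆ k, V.tensorWeight k), LinearMap.ker_eq_top]
  refine GrVect.tensor_hom_ext fun i j x hx y hy => ?_
  rw [Submodule.mkQ_apply, LinearMap.zero_apply, Submodule.Quotient.mk_eq_zero]
  exact le_iSup V.tensorWeight (i + j) (GrVect.tmul_mem_tensorWeight rfl hx hy)

theorem GrVect.sum_apply_proj_tmul_proj {M : Type*} [AddCommGroup M] [Module F M] {N k : ℤ}
    (hN : ∀ k < N, Subsingleton (V k)) {φ : V.Total ⊗[F] V.Total →ₗ[F] M}
    (hφ : ∀ j ≠ k, ∀ X ∈ V.tensorWeight j, φ X = 0) :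
    ∑ i ∈ Finset.Icc N (k - N), φ ∘ₗ TensorProduct.map (V.proj i) (V.proj (k - i)) = φ := by
  refine GrVect.tensor_hom_ext fun a b x hx y hy => ?_
  simp only [LinearMap.sum_apply, LinearMap.comp_apply, TensorProduct.map_tmul]
  rcases ne_or_eq (a + b) k with hab | rfl
  · rw [hφ _ hab _ (GrVect.tmul_mem_tensorWeight rfl hx hy)]
    refine Finset.sum_eq_zero fun i _ => ?_
    rcases (by lia : a ≠ i ∨ b ≠ k - i) with ha | hb
    · rw [GrVect.proj_of_mem_ne ha hx, TensorProduct.zero_tmul, map_zero]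
    · rw [GrVect.proj_of_mem_ne hb hy, TensorProduct.tmul_zero, map_zero]
  · rw [Finset.sum_eq_single a, GrVect.proj_of_mem hx, add_sub_cancel_left, GrVect.proj_of_mem hy]
    · intro i _ hi
      rw [GrVect.proj_of_mem_ne hi.symm hx, TensorProduct.zero_tmul, map_zero]
    · intro ha
      rcases (by grind : a < N ∨ b < N) with h | h
      · have := hN a h
        rw [V.weight_eq_bot, Submodule.mem_bot] at hx
        simp [hx]
      · have := hN b h
        rw [V.weight_eq_bot, Submodule.mem_bot] at hy
        simp [hy]

theorem dualDistrib_comp_proj_left_eq_right {V : GrVect.{u, v} F} {i j r : ℤ} (hij : i + j = r)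
    {X : V.Total ⊗[F] V.Total} (hX : X ∈ V.tensorWeight r) (f f' : Module.Dual F V.Total) :
    TensorProduct.dualDistrib F _ _ ((f ∘ₗ V.proj i) ⊗ₜ f') X
      = TensorProduct.dualDistrib F _ _ (f ⊗ₜ (f' ∘ₗ V.proj j)) X := by
  suffices V.tensorWeight r ≤ LinearMap.eqLocus
      (TensorProduct.dualDistrib F _ _ ((f ∘ₗ V.proj i) ⊗ₜ f'))
      (TensorProduct.dualDistrib F _ _ (f ⊗ₜ (f' ∘ₗ V.proj j))) from this hX
  refine GrVect.tensorWeight_le_iff.2 fun a b hab x hx y hy => ?_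
  rw [LinearMap.mem_eqLocus, TensorProduct.dualDistrib_apply, TensorProduct.dualDistrib_apply,
    LinearMap.comp_apply, LinearMap.comp_apply]
  rcases eq_or_ne a i with rfl | ha
  · obtain rfl : b = j := by lia
    rw [GrVect.proj_of_mem hx, GrVect.proj_of_mem hy]
  · have hb : b ≠ j := by lia
    rw [GrVect.proj_of_mem_ne ha hx, GrVect.proj_of_mem_ne hb hy, map_zero, map_zero, zero_mul,
      mul_zero]

end GradedSpace

/-! ### The pairing of a graded vector space with its graded dual -/

section Pairing

variable {F : Type u} [Field F] (V : GrVect.{u, max u v} F)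

/-- The graded dual `∐ k, Hom(V_(k), F)` of a graded vector space. -/
abbrev GrVect.dual : GrVect.{u, max u v} F := (gradedDual.{u, v} F).obj (op V)

variable {V}

theorem GrVect.subsingleton_dual {k : ℤ} [Subsingleton (V k)] :
    Subsingleton (GrVect.dual.{u, v} V k) :=
  inferInstanceAs (Subsingleton (Module.Dual F (V k)))

theorem GrVect.BoundedBelow.dual (h : V.BoundedBelow) : (GrVect.dual.{u, v} V).BoundedBelow :=
  h.imp fun _ hN k hk =>
    have : Subsingleton (V k) := hN k hk
    GrVect.subsingleton_dual.{u, v} (V := V)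

theorem GrVect.finite_dual (h : ∀ k, FiniteDimensional F (V k)) (k : ℤ) :
    FiniteDimensional F (GrVect.dual.{u, v} V k) :=
  have := h k
  inferInstanceAs (FiniteDimensional F (Module.Dual F (V k)))

variable (V) in
/-- The inclusion of the dual of `V_(k)` into the graded dual of `V`. -/
abbrev GrVect.dualLof (k : ℤ) : Module.Dual F (V k) →ₗ[F] (GrVect.dual.{u, v} V).Total :=
  DirectSum.lof F ℤ (fun k => GrVect.dual.{u, v} V k) k

variable (V) in
/-- The degree `k` component of an element of the graded dual of `V`, as a functional on `V_(k)`. -/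
abbrev GrVect.dualComponent (k : ℤ) : (GrVect.dual.{u, v} V).Total →ₗ[F] Module.Dual F (V k) :=
  DirectSum.component F ℤ (fun k => GrVect.dual.{u, v} V k) k

theorem isAdjointPair_dualLof (k : ℤ) :
    IsAdjointPair LinearMap.id (pairing.{u, v} V) (GrVect.dualLof.{u, v} V k)
      (DirectSum.component F ℤ (fun k => V k) k) := fun f =>
  LinearMap.congr_fun (DirectSum.toModule_lof (M := fun k => GrVect.dual.{u, v} V k) F
    (φ := fun k => (DirectSum.component F ℤ (fun k => V k) k).dualMap) k f)

theorem pairing_dualLof (k : ℤ) (f : Module.Dual F (V k)) (x : V.Total) :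
    pairing.{u, v} V (GrVect.dualLof.{u, v} V k f) x = f (x k) :=
  isAdjointPair_dualLof k f x

theorem pairing_eq_zero_of_mem {j k : ℤ} (hjk : j ≠ k) {ξ : (GrVect.dual.{u, v} V).Total}
    (hξ : ξ ∈ (GrVect.dual.{u, v} V).weight j) {x : V.Total} (hx : x ∈ V.weight k) :
    pairing.{u, v} V ξ x = 0 := by
  obtain ⟨f, rfl⟩ := hξ
  obtain ⟨x, rfl⟩ := hx
  refine (pairing_dualLof j f _).trans ?_
  rw [DirectSum.lof_eq_of, DirectSum.of_eq_of_ne _ _ _ hjk]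
  exact map_zero (show Module.Dual F (V j) from f)

theorem pairing_lof (ξ : (GrVect.dual.{u, v} V).Total) (k : ℤ) (x : V k) :
    pairing.{u, v} V ξ (DirectSum.lof F ℤ (fun k => V k) k x)
      = GrVect.dualComponent.{u, v} V k ξ x := by
  induction ξ using DirectSum.induction_on with
  | zero => simp only [map_zero, LinearMap.zero_apply]
  | add ξ ζ hξ hζ => simp only [map_add, LinearMap.add_apply, hξ, hζ]
  | of j f =>
    rcases ne_or_eq j k with hjk | rfl
    · refine (pairing_eq_zero_of_mem hjk ⟨f, rfl⟩ ⟨x, rfl⟩).trans ?_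
      have : GrVect.dualComponent.{u, v} V k (DirectSum.of _ j f) = 0 :=
        DirectSum.of_eq_of_ne _ _ _ hjk.symm
      rw [this, LinearMap.zero_apply]
    · have : GrVect.dualComponent.{u, v} V j (DirectSum.of _ j f) = f := DirectSum.of_eq_same _ _
      rw [this]
      have hx : DirectSum.lof F ℤ (fun k => V k) j x j = x := DirectSum.of_eq_same _ _
      exact (pairing_dualLof j f _).trans (congrArg (show Module.Dual F (V j) from f) hx)

theorem pairing_injective : Function.Injective (pairing.{u, v} V) := fun ξ ζ h =>
  DirectSum.ext_component F fun k => LinearMap.ext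
    (f := GrVect.dualComponent.{u, v} V k ξ) (g := GrVect.dualComponent.{u, v} V k ζ) fun x => by
      rw [← pairing_lof, h, pairing_lof]

theorem isGradedDualPairing_pairing (V : GrVect.{u, max u v} F) :
    IsGradedDualPairing (pairing.{u, v} V) (GrVect.dual.{u, v} V).weight V.weight where
  injective := pairing_injective
  iSup_eq_top := GrVect.iSup_weight
  orthogonal _ _ hjk _ hξ _ hx := pairing_eq_zero_of_mem hjk hξ hx
  exists_apply_eq k φ hφ := by
    refine ⟨GrVect.dualLof.{u, v} V k (φ ∘ₗ DirectSum.lof F ℤ (fun k => V k) k), ⟨_, rfl⟩, ?_⟩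
    refine DirectSum.linearMap_ext F fun j => LinearMap.ext fun x => ?_
    rw [LinearMap.comp_apply, LinearMap.comp_apply]
    rcases ne_or_eq k j with hkj | rfl
    · rw [hφ j hkj.symm _ ⟨x, rfl⟩]
      exact pairing_eq_zero_of_mem hkj ⟨_, rfl⟩ ⟨x, rfl⟩
    · rw [pairing_dualLof, DirectSum.lof_eq_of, DirectSum.of_eq_same]
      rfl

theorem tensorPairing_eq_zero_of_mem {j k : ℤ} (hjk : j ≠ k)
    {X : (GrVect.dual.{u, v} V).Total ⊗[F] (GrVect.dual.{u, v} V).Total}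
    (hX : X ∈ (GrVect.dual.{u, v} V).tensorWeight j) {Z : V.Total ⊗[F] V.Total}
    (hZ : Z ∈ V.tensorWeight k) : tensorPairing.{u, v} V X Z = 0 := by
  suffices (GrVect.dual.{u, v} V).tensorWeight j ≤
      (V.tensorWeight k).dualAnnihilator.comap (tensorPairing.{u, v} V) from
    (Submodule.mem_dualAnnihilator _).1 (this hX) Z hZ
  refine GrVect.tensorWeight_le_iff.2 fun a b hab ξ hξ ζ hζ =>
    (Submodule.mem_dualAnnihilator _).2 ?_
  suffices V.tensorWeight k ≤ LinearMap.ker (tensorPairing.{u, v} V (ξ ⊗ₜ ζ)) from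
    fun Z hZ => this hZ
  refine GrVect.tensorWeight_le_iff.2 fun a' b' hab' x hx y hy => ?_
  change pairing.{u, v} V ξ x * pairing.{u, v} V ζ y = 0
  rcases (by lia : a ≠ a' ∨ b ≠ b') with ha | hb
  · rw [pairing_eq_zero_of_mem ha hξ hx, zero_mul]
  · rw [pairing_eq_zero_of_mem hb hζ hy, mul_zero]

theorem tmulPairing_id_surjective {R M N : Type*} [CommRing R] [AddCommGroup M] [Module R M]
    [Module.Finite R M] [Module.Free R M] [AddCommGroup N] [Module R N] [Module.Finite R N]
    [Module.Free R N] :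
    Function.Surjective
      (tmulPairing (LinearMap.id (R := R) (M := Module.Dual R M))
        (LinearMap.id (R := R) (M := Module.Dual R N))) := by
  rw [tmulPairing, TensorProduct.map_id, LinearMap.comp_id]
  exact (TensorProduct.dualDistribEquiv R M N).surjective

theorem exists_tensorPairing_eq (hV : V.BoundedBelow) (hfin : ∀ k, FiniteDimensional F (V k))
    {k : ℤ} {φ : Module.Dual F (V.Total ⊗[F] V.Total)}
    (hφ : ∀ j ≠ k, ∀ X ∈ V.tensorWeight j, φ X = 0) :
    ∃ X ∈ (GrVect.dual.{u, v} V).tensorWeight k, tensorPairing.{u, v} V X = φ := by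
  obtain ⟨N, hN⟩ := hV
  let lof i := DirectSum.lof F ℤ (fun k => V k) i
  choose Z hZ using fun i =>
    tmulPairing_id_surjective (φ ∘ₗ TensorProduct.map (lof i) (lof (k - i)))
  refine ⟨∑ i ∈ Finset.Icc N (k - N), TensorProduct.map (GrVect.dualLof.{u, v} V i)
    (GrVect.dualLof.{u, v} V (k - i)) (Z i),
    Submodule.sum_mem _ fun i _ => Submodule.mem_iSup_of_mem i ⟨Z i, rfl⟩, ?_⟩
  rw [map_sum, ← GrVect.sum_apply_proj_tmul_proj hN hφ]
  refine Finset.sum_congr rfl fun i _ => LinearMap.ext fun X => ?_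
  refine ((isAdjointPair_dualLof i).tmul (isAdjointPair_dualLof (k - i)) (Z i) X).trans ?_
  rw [GrVect.proj, GrVect.proj, TensorProduct.map_comp, ← LinearMap.comp_assoc, ← hZ]
  rfl

theorem isGradedDualPairing_tensorPairing (hV : V.BoundedBelow)
    (hfin : ∀ k, FiniteDimensional F (V k)) :
    IsGradedDualPairing (tensorPairing.{u, v} V) (GrVect.dual.{u, v} V).tensorWeight
      V.tensorWeight where
  injective := tmulPairing_injective pairing_injective pairing_injective
  iSup_eq_top := GrVect.iSup_tensorWeight
  orthogonal _ _ hjk _ hX _ hZ := tensorPairing_eq_zero_of_mem hjk hX hZ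
  exists_apply_eq _ _ := exists_tensorPairing_eq hV hfin

theorem isAdjointPair_total_gradedDual_map {V W : GrVect.{u, max u v} F} (f : V ⟶ W) :
    IsAdjointPair (pairing.{u, v} W) (pairing.{u, v} V)
      (GrVect.total ((gradedDual.{u, v} F).map f.op)) (GrVect.total f) := fun ξ x => by
  induction x using DirectSum.induction_on with
  | zero => simp
  | add x y hx hy => simp only [map_add, hx, hy]
  | of k x =>
    rw [← DirectSum.lof_eq_of F, pairing_lof, DirectSum.lmap_lof, pairing_lof]
    rfl

theorem isAdjointPair_total_toDoubleDual (V : GrVect.{u, max u v} F) :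
    IsAdjointPair (pairing.{u, v} V).flip (pairing.{u, v} (GrVect.dual.{u, v} V))
      (GrVect.total (toDoubleDual.{u, v} V)) LinearMap.id := fun x ξ => by
  induction x using DirectSum.induction_on with
  | zero => simp
  | add x y hx hy => simp only [map_add, LinearMap.add_apply, hx, hy]
  | of k x =>
    rw [← DirectSum.lof_eq_of F, DirectSum.lmap_lof, LinearMap.flip_apply, LinearMap.id_apply,
      pairing_lof]
    exact pairing_dualLof k _ ξ

theorem isIso_toDoubleDual [∀ k, FiniteDimensional F (V k)] : IsIso (toDoubleDual.{u, v} V) :=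
  (isIso_pi_iff _).2 fun k => (LinearEquiv.toModuleIso (Module.evalEquiv F (V k))).isIso_hom

end Pairing

/-! ### Duals of vertex algebras and vertex coalgebras -/

section Dual

variable {F : Type u} [Field F]

namespace FDGVertexAlgebra

theorem Y_mem (A : FDGVertexAlgebra.{u, v} F) {j k : ℤ} {x y : A.space.Total}
    (hx : x ∈ A.space.weight j) (hy : y ∈ A.space.weight k) (n : ℤ) :
    A.str.Y x n y ∈ A.space.weight (j + k + n) := by
  have h := A.graded j k (-n - 1) x hx y hy
  rwa [show -(-n - 1) - 1 = n by ring, show j + k - (-n - 1) - 1 = j + k + n by ring] at h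

theorem lift_Y_mem (A : FDGVertexAlgebra.{u, v} F) (n k : ℤ) :
    ∀ X ∈ A.space.tensorWeight k,
      TensorProduct.lift (LinearMap.proj n ∘ₗ A.str.Y) X ∈ A.space.weight (k + n) := by
  suffices A.space.tensorWeight k ≤ (A.space.weight (k + n)).comap
      (TensorProduct.lift (LinearMap.proj n ∘ₗ A.str.Y)) from this
  refine GrVect.tensorWeight_le_iff.2 fun i j hij x hx y hy => ?_
  exact hij ▸ A.Y_mem hx hy n

variable (A : FDGVertexAlgebra.{u, max u v} F)

/-- The coefficient of `x ^ n` in the coproduct on the graded dual of `A`: the transpose of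
`v ⊗ w ↦ v_{-n-1} w`. -/
def coproductMode (n : ℤ) : (GrVect.dual.{u, v} A.space).Total →ₗ[F]
    (GrVect.dual.{u, v} A.space).Total ⊗[F] (GrVect.dual.{u, v} A.space).Total :=
  (isGradedDualPairing_pairing.{u, v} A.space).transpose
    (isGradedDualPairing_tensorPairing.{u, v} A.boundedBelow A.finite) (A.lift_Y_mem n)

theorem coproductMode_mem (n r : ℤ) : ∀ ξ ∈ (GrVect.dual.{u, v} A.space).weight r,
    coproductMode.{u, v} A n ξ ∈ (GrVect.dual.{u, v} A.space).tensorWeight (r - n) := fun _ hξ =>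
  (isGradedDualPairing_pairing.{u, v} A.space).transpose_mem
    (isGradedDualPairing_tensorPairing.{u, v} A.boundedBelow A.finite) (A.lift_Y_mem n) hξ

theorem areTransposeOperations_coproductMode :
    AreTransposeOperations (pairing.{u, v} A.space) (LinearMap.pi (coproductMode.{u, v} A))
      A.str.Y := fun n =>
  (isGradedDualPairing_pairing.{u, v} A.space).isAdjointPair_transpose
    (isGradedDualPairing_tensorPairing.{u, v} A.boundedBelow A.finite) (A.lift_Y_mem n)

/-- The graded dual of a graded vertex algebra. -/
abbrev dual : FDGVertexCoalgebra.{u, max u v} F where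
  space := GrVect.dual.{u, v} A.space
  str := VertexCoalgebra.ofTranspose A.str pairing_injective
    (areTransposeOperations_coproductMode.{u, v} A) <|
      have ⟨_, hN⟩ := A.boundedBelow.dual
      exists_forall_gt_apply_eq_zero GrVect.iSup_weight
        (fun _ hk => GrVect.tensorWeight_eq_bot hN hk) (coproductMode_mem.{u, v} A)
  boundedBelow := A.boundedBelow.dual
  finite := GrVect.finite_dual A.finite
  graded r k ξ hξ := by
    have h := coproductMode_mem.{u, v} A (-k - 1) r ξ hξ
    rwa [show r - (-k - 1) = r + k + 1 by ring] at h

end FDGVertexAlgebra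

namespace FDGVertexCoalgebra

theorem Y_mem (C : FDGVertexCoalgebra.{u, v} F) (n r : ℤ) : ∀ x ∈ C.space.weight r,
    C.str.Y x n ∈ C.space.tensorWeight (r - n) := fun x hx => by
  have h := C.graded r (-n - 1) x hx
  rwa [show -(-n - 1) - 1 = n by ring, show r + (-n - 1) + 1 = r - n by ring] at h

theorem c_eq_zero_of_mem (C : FDGVertexCoalgebra.{u, v} F) {r : ℤ} (hr : r ≠ 0)
    {x : C.space.Total} (hx : x ∈ C.space.weight r) : C.str.c x = 0 :=
  have hX : C.str.Y x 0 ∈ C.space.tensorWeight r := by simpa using C.Y_mem 0 r x hx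
  calc
    C.str.c x = (C.str.c ∘ₗ C.space.proj r)
        (TensorProduct.rid F _ (C.str.c.lTensor _ (C.str.Y x 0))) := by
      rw [C.str.cocreation_zero, LinearMap.comp_apply, GrVect.proj_of_mem hx]
    _ = (C.str.c ∘ₗ C.space.proj 0)
        (TensorProduct.lid F _ (C.str.c.rTensor _ (C.str.Y x 0))) := by
      rw [← dualDistrib_tmul_eq_apply_rid, ← dualDistrib_tmul_eq_apply_lid,
        dualDistrib_comp_proj_left_eq_right (add_zero r) hX]
    _ = 0 := by
      rw [C.str.counit, if_pos rfl, LinearMap.comp_apply, GrVect.proj_of_mem_ne hr hx, map_zero]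

variable (C : FDGVertexCoalgebra.{u, max u v} F)

/-- The coefficient of `x ^ n` in the product `f ⊗ g ↦ Y(f, x) g` on the graded dual of `C`: the
transpose of `Δ_{-n-1}`. -/
def productMode (n : ℤ) :
    (GrVect.dual.{u, v} C.space).Total ⊗[F] (GrVect.dual.{u, v} C.space).Total →ₗ[F]
      (GrVect.dual.{u, v} C.space).Total :=
  (isGradedDualPairing_tensorPairing.{u, v} C.boundedBelow C.finite).transpose
    (isGradedDualPairing_pairing.{u, v} C.space) (g := LinearMap.proj n ∘ₗ C.str.Y) (d := -n)
    (C.Y_mem n)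

theorem productMode_mem (n r : ℤ) : ∀ X ∈ (GrVect.dual.{u, v} C.space).tensorWeight r,
    productMode.{u, v} C n X ∈ (GrVect.dual.{u, v} C.space).weight (r + n) := fun X hX => by
  have h := (isGradedDualPairing_tensorPairing.{u, v} C.boundedBelow C.finite).transpose_mem
    (isGradedDualPairing_pairing.{u, v} C.space) (g := LinearMap.proj n ∘ₗ C.str.Y) (d := -n)
    (C.Y_mem n) hX
  rwa [sub_neg_eq_add] at h

/-- The product on the graded dual of `C`, as a vertex operator map. -/
def product : (GrVect.dual.{u, v} C.space).Total →ₗ[F]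
    (ℤ → Module.End F (GrVect.dual.{u, v} C.space).Total) :=
  LinearMap.pi fun n => TensorProduct.curry (productMode.{u, v} C n)

theorem areTransposeOperations_product :
    AreTransposeOperations (pairing.{u, v} C.space).flip C.str.Y (product.{u, v} C) := fun n => by
  have h : IsAdjointPair (tensorPairing.{u, v} C.space) (pairing.{u, v} C.space)
      (productMode.{u, v} C n) (LinearMap.proj n ∘ₗ C.str.Y) :=
    (isGradedDualPairing_tensorPairing.{u, v} C.boundedBelow C.finite).isAdjointPair_transpose
      (isGradedDualPairing_pairing.{u, v} C.space) (C.Y_mem n)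
  have hn : TensorProduct.lift (LinearMap.proj n ∘ₗ product.{u, v} C) = productMode.{u, v} C n :=
    TensorProduct.ext' fun _ _ => rfl
  rw [hn, ← tmulPairing_flip]
  exact h.flip

theorem product_truncation (f g : (GrVect.dual.{u, v} C.space).Total) :
    ∃ N : ℤ, ∀ n < N, product.{u, v} C f n g = 0 := by
  obtain ⟨_, hN⟩ := C.boundedBelow.dual
  obtain ⟨M, hM⟩ := exists_forall_gt_apply_eq_zero GrVect.iSup_tensorWeight
    (fun k hk => have := hN k hk; GrVect.weight_eq_bot k)
    (T := fun n => productMode.{u, v} C (-n)) (fun n => productMode_mem.{u, v} C (-n)) (f ⊗ₜ g)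
  refine ⟨-M, fun n hn => ?_⟩
  have h := hM (-n) (by lia)
  rwa [neg_neg] at h

theorem exists_pairing_eq_c : ∃ e : (GrVect.dual.{u, v} C.space).Total,
    pairing.{u, v} C.space e = C.str.c :=
  have ⟨e, _, h⟩ := (isGradedDualPairing_pairing.{u, v} C.space).exists_apply_eq 0 C.str.c
    fun _ hr _ hx => C.c_eq_zero_of_mem hr hx
  ⟨e, h⟩

/-- The covacuum of `C`, as an element of the graded dual. -/
def dualVac : (GrVect.dual.{u, v} C.space).Total := (exists_pairing_eq_c.{u, v} C).choose

theorem pairing_dualVac : pairing.{u, v} C.space (dualVac.{u, v} C) = C.str.c :=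
  (exists_pairing_eq_c.{u, v} C).choose_spec

/-- The graded dual of a graded vertex coalgebra. -/
abbrev dual : FDGVertexAlgebra.{u, max u v} F where
  space := GrVect.dual.{u, v} C.space
  str := VertexAlgebra.ofTranspose C.str (B := (pairing.{u, v} C.space).flip) pairing_injective
    (areTransposeOperations_product.{u, v} C) (product_truncation.{u, v} C)
    (dualVac.{u, v} C) (pairing_dualVac.{u, v} C)
  boundedBelow := C.boundedBelow.dual
  finite := GrVect.finite_dual C.finite
  graded j k n f hf g hg := by
    have h := productMode_mem.{u, v} C (-n - 1) _ _ (GrVect.tmul_mem_tensorWeight rfl hf hg)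
    rwa [show j + k + (-n - 1) = j + k - n - 1 by ring] at h

end FDGVertexCoalgebra

end Dual

/-! ### Dualization as an equivalence of categories -/

section Functors

variable {F : Type u} [Field F]

theorem GrVect.total_total_inv {V W : GrVect.{u, v} F} (f : V ⟶ W) [IsIso f] (x : W.Total) :
    GrVect.total f (GrVect.total (inv f) x) = x := by
  rw [← LinearMap.comp_apply, ← GrVect.total_comp, IsIso.inv_hom_id, GrVect.total_id,
    LinearMap.id_apply]

theorem GrVect.total_inv_total {V W : GrVect.{u, v} F} (f : V ⟶ W) [IsIso f] (x : V.Total) :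
    GrVect.total (inv f) (GrVect.total f x) = x := by
  rw [← LinearMap.comp_apply, ← GrVect.total_comp, IsIso.hom_inv_id, GrVect.total_id,
    LinearMap.id_apply]

namespace FDGVertexAlgebra

/-- A morphism of graded vertex algebras which is invertible as a map of graded vector spaces, as
an isomorphism. -/
def isoOfIsIso {A B : FDGVertexAlgebra.{u, v} F} (f : A ⟶ B) [IsIso (Hom.map f)] : A ≅ B where
  hom := f
  inv :=
    { map := inv f.map
      map_Y u w n := by
        conv_lhs => rw [← GrVect.total_total_inv f.map u, ← GrVect.total_total_inv f.map w]
        rw [← f.map_Y, GrVect.total_inv_total]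
      map_vac := by rw [← f.map_vac, GrVect.total_inv_total] }
  hom_inv_id := Hom.ext (IsIso.hom_inv_id f.map)
  inv_hom_id := Hom.ext (IsIso.inv_hom_id f.map)

/-- The transpose of a morphism of graded vertex algebras. -/
def dualMap {A B : FDGVertexAlgebra.{u, max u v} F} (f : A ⟶ B) :
    dual.{u, v} B ⟶ dual.{u, v} A where
  map := (gradedDual.{u, v} F).map (Hom.map f).op
  map_Y := (areTransposeOperations_coproductMode.{u, v} A).map_coproduct
    (areTransposeOperations_coproductMode.{u, v} B)
    (isAdjointPair_total_gradedDual_map.{u, v} f.map) pairing_injective f.map_Y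
  map_c ξ := (isAdjointPair_total_gradedDual_map.{u, v} f.map ξ A.str.vac).trans
    (congrArg (pairing.{u, v} B.space ξ) f.map_vac)

end FDGVertexAlgebra

namespace FDGVertexCoalgebra

/-- A morphism of graded vertex coalgebras which is invertible as a map of graded vector spaces, as
an isomorphism. -/
def isoOfIsIso {C D : FDGVertexCoalgebra.{u, v} F} (f : C ⟶ D) [IsIso (Hom.map f)] : C ≅ D where
  hom := f
  inv :=
    { map := inv f.map
      map_Y w n := by
        conv_lhs => rw [← GrVect.total_total_inv f.map w]
        rw [← f.map_Y, ← LinearMap.comp_apply, ← TensorProduct.map_comp, ← GrVect.total_comp,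
          IsIso.hom_inv_id, GrVect.total_id, TensorProduct.map_id, LinearMap.id_apply]
      map_c w := by rw [← f.map_c, GrVect.total_total_inv] }
  hom_inv_id := Hom.ext (IsIso.hom_inv_id f.map)
  inv_hom_id := Hom.ext (IsIso.inv_hom_id f.map)

/-- The transpose of a morphism of graded vertex coalgebras. -/
def dualMap {C D : FDGVertexCoalgebra.{u, max u v} F} (f : C ⟶ D) :
    dual.{u, v} D ⟶ dual.{u, v} C where
  map := (gradedDual.{u, v} F).map (Hom.map f).op
  map_Y := (areTransposeOperations_product.{u, v} D).map_product
    (areTransposeOperations_product.{u, v} C) (isAdjointPair_total_gradedDual_map.{u, v} f.map).flip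
    pairing_injective f.map_Y
  map_vac := pairing_injective <| LinearMap.ext fun w => by
    refine (isAdjointPair_total_gradedDual_map.{u, v} f.map (dualVac.{u, v} D) w).trans ?_
    rw [pairing_dualVac, f.map_c]
    exact (LinearMap.congr_fun (pairing_dualVac.{u, v} C) w).symm

end FDGVertexCoalgebra

variable (F) in
/-- Graded dualization, from graded vertex algebras to graded vertex coalgebras. -/
def dualCoalgebraFunctor :
    (FDGVertexAlgebra.{u, max u v} F)ᵒᵖ ⥤ FDGVertexCoalgebra.{u, max u v} F where
  obj A := FDGVertexAlgebra.dual.{u, v} A.unop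
  map f := FDGVertexAlgebra.dualMap.{u, v} f.unop
  map_id A := FDGVertexCoalgebra.Hom.ext ((gradedDual.{u, v} F).map_id (op A.unop.space))
  map_comp f g := FDGVertexCoalgebra.Hom.ext
    ((gradedDual.{u, v} F).map_comp f.unop.map.op g.unop.map.op)

variable (F) in
/-- Graded dualization, from graded vertex coalgebras to graded vertex algebras. -/
def dualAlgebraFunctor :
    FDGVertexCoalgebra.{u, max u v} F ⥤ (FDGVertexAlgebra.{u, max u v} F)ᵒᵖ where
  obj C := op (FDGVertexCoalgebra.dual.{u, v} C)
  map f := (FDGVertexCoalgebra.dualMap.{u, v} f).op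
  map_id C := congrArg Quiver.Hom.op
    (FDGVertexAlgebra.Hom.ext ((gradedDual.{u, v} F).map_id (op C.space)))
  map_comp f g := congrArg Quiver.Hom.op
    (FDGVertexAlgebra.Hom.ext ((gradedDual.{u, v} F).map_comp g.map.op f.map.op))

/-- The canonical map from a graded vertex algebra to its double dual. -/
def FDGVertexAlgebra.toDoubleDual (A : FDGVertexAlgebra.{u, max u v} F) :
    A ⟶ FDGVertexCoalgebra.dual.{u, v} (FDGVertexAlgebra.dual.{u, v} A) where
  map := VertexDuality.toDoubleDual.{u, v} A.space
  map_Y :=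
    let A' := FDGVertexAlgebra.dual.{u, v} A
    (areTransposeOperations_coproductMode.{u, v} A).map_product
      (FDGVertexCoalgebra.areTransposeOperations_product.{u, v} A')
      (isAdjointPair_total_toDoubleDual.{u, v} A.space).flip
      pairing_injective fun p n => LinearMap.congr_fun TensorProduct.map_id (A'.str.Y p n)
  map_vac := pairing_injective <| LinearMap.ext fun ξ =>
    (isAdjointPair_total_toDoubleDual.{u, v} A.space A.str.vac ξ).trans
      (LinearMap.congr_fun (FDGVertexCoalgebra.pairing_dualVac.{u, v}
        (FDGVertexAlgebra.dual.{u, v} A)) ξ).symm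

/-- The canonical map from a graded vertex coalgebra to its double dual. -/
def FDGVertexCoalgebra.toDoubleDual (C : FDGVertexCoalgebra.{u, max u v} F) :
    C ⟶ FDGVertexAlgebra.dual.{u, v} (FDGVertexCoalgebra.dual.{u, v} C) where
  map := VertexDuality.toDoubleDual.{u, v} C.space
  map_Y := (FDGVertexAlgebra.areTransposeOperations_coproductMode.{u, v}
      (FDGVertexCoalgebra.dual.{u, v} C)).map_coproduct
    (areTransposeOperations_product.{u, v} C) (isAdjointPair_total_toDoubleDual.{u, v} C.space)
    pairing_injective fun _ _ _ => rfl
  map_c w := (isAdjointPair_total_toDoubleDual.{u, v} C.space w _).trans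
    (LinearMap.congr_fun (pairing_dualVac.{u, v} C) w)

/-- The canonical isomorphism of a graded vertex algebra with its double dual. -/
def FDGVertexAlgebra.doubleDualIso (A : FDGVertexAlgebra.{u, max u v} F) :
    A ≅ FDGVertexCoalgebra.dual.{u, v} (FDGVertexAlgebra.dual.{u, v} A) :=
  have := A.finite
  have : IsIso (toDoubleDual.{u, v} A).map := isIso_toDoubleDual.{u, v}
  isoOfIsIso (toDoubleDual.{u, v} A)

/-- The canonical isomorphism of a graded vertex coalgebra with its double dual. -/
def FDGVertexCoalgebra.doubleDualIso (C : FDGVertexCoalgebra.{u, max u v} F) :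
    C ≅ FDGVertexAlgebra.dual.{u, v} (FDGVertexCoalgebra.dual.{u, v} C) :=
  have := C.finite
  have : IsIso (toDoubleDual.{u, v} C).map := isIso_toDoubleDual.{u, v}
  isoOfIsIso (toDoubleDual.{u, v} C)

theorem toDoubleDual_naturality {V W : GrVect.{u, max u v} F} (f : V ⟶ W) :
    f ≫ toDoubleDual.{u, v} W = toDoubleDual.{u, v} V ≫
      (gradedDual.{u, v} F).map ((gradedDual.{u, v} F).map f.op).op := rfl

theorem toDoubleDual_comp_gradedDual_map_toDoubleDual (V : GrVect.{u, max u v} F) :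
    toDoubleDual.{u, v} (GrVect.dual.{u, v} V)
      ≫ (gradedDual.{u, v} F).map (toDoubleDual.{u, v} V).op = 𝟙 (GrVect.dual.{u, v} V) := rfl

variable (F) in
/-- Graded dualization as a contravariant equivalence between graded vertex algebras and graded
vertex coalgebras, with the canonical isomorphisms `V ≅ V''` as unit and counit. -/
def dualityEquivalence :
    (FDGVertexAlgebra.{u, max u v} F)ᵒᵖ ≌ FDGVertexCoalgebra.{u, max u v} F where
  functor := dualCoalgebraFunctor.{u, v} F
  inverse := dualAlgebraFunctor.{u, v} F
  unitIso := (NatIso.ofComponents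
    (F := dualCoalgebraFunctor.{u, v} F ⋙ dualAlgebraFunctor.{u, v} F) (G := 𝟭 _)
    (fun A => (FDGVertexAlgebra.doubleDualIso.{u, v} A.unop).op)
    (fun f => congrArg Quiver.Hom.op
      (FDGVertexAlgebra.Hom.ext (toDoubleDual_naturality.{u, v} f.unop.map).symm))).symm
  counitIso := (NatIso.ofComponents
    (F := 𝟭 _) (G := dualAlgebraFunctor.{u, v} F ⋙ dualCoalgebraFunctor.{u, v} F)
    (fun C => FDGVertexCoalgebra.doubleDualIso.{u, v} C)
    (fun f => FDGVertexCoalgebra.Hom.ext (toDoubleDual_naturality.{u, v} f.map))).symm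
  functor_unitIso_comp A :=
    have h : FDGVertexCoalgebra.doubleDualIso.{u, v} (FDGVertexAlgebra.dual.{u, v} A.unop) ≪≫
        (dualCoalgebraFunctor.{u, v} F).mapIso
          (FDGVertexAlgebra.doubleDualIso.{u, v} A.unop).op = Iso.refl _ :=
      Iso.ext (FDGVertexCoalgebra.Hom.ext
        (toDoubleDual_comp_gradedDual_map_toDoubleDual.{u, v} A.unop.space))
    congrArg Iso.inv h

theorem isDualCoalgebra_dual (A : FDGVertexAlgebra.{u, max u v} F) :
    IsDualCoalgebra.{u, v} A (FDGVertexAlgebra.dual.{u, v} A) (Iso.refl _) where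
  coproduct ξ v w n := by
    rw [Iso.refl_hom, GrVect.total_id, TensorProduct.map_id]
    exact (FDGVertexAlgebra.areTransposeOperations_coproductMode.{u, v} A).tmulPairing_apply ξ v w n
  covacuum ξ := by
    rw [Iso.refl_hom, GrVect.total_id]
    rfl

theorem isDualAlgebra_dual (C : FDGVertexCoalgebra.{u, max u v} F) :
    IsDualAlgebra.{u, v} C (FDGVertexCoalgebra.dual.{u, v} C) (Iso.refl _) where
  product f g w n := by
    rw [Iso.refl_hom, GrVect.total_id]
    refine ((FDGVertexCoalgebra.areTransposeOperations_product.{u, v} C).tmulPairing_apply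
      w f g n).symm.trans ?_
    rw [← tmulPairing_flip]
    rfl
  vacuum w := by
    rw [Iso.refl_hom, GrVect.total_id]
    exact LinearMap.congr_fun (FDGVertexCoalgebra.pairing_dualVac.{u, v} C) w

end Functors

end

end VertexDuality

open VertexDuality

theorem mainTheorem2_general (F : Type u) [Field F] :
    ∃ (e : (FDGVertexAlgebra.{u, max u v} F)ᵒᵖ ≌ FDGVertexCoalgebra.{u, max u v} F)
      (α : e.functor ⋙ FDGVertexCoalgebra.forget F
        ≅ (FDGVertexAlgebra.forget F).op ⋙ gradedDual.{u, v} F)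
      (β : e.inverse.leftOp ⋙ FDGVertexAlgebra.forget F
        ≅ (FDGVertexCoalgebra.forget F).op ⋙ gradedDual.{u, v} F),
      (∀ A : FDGVertexAlgebra.{u, max u v} F,
        IsDualCoalgebra.{u, v} A (e.functor.obj (op A)) (α.app (op A))) ∧
      (∀ C : FDGVertexCoalgebra.{u, max u v} F,
        IsDualAlgebra.{u, v} C (e.inverse.obj C).unop (β.app (op C))) ∧
      (∀ A : FDGVertexAlgebra.{u, max u v} F,
        (FDGVertexAlgebra.forget F).map (e.unitInv.app (op A)).unop
            ≫ β.hom.app (op (e.functor.obj (op A)))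
          = toDoubleDual.{u, v} A.space ≫ (gradedDual.{u, v} F).map (α.hom.app (op A)).op) ∧
      (∀ C : FDGVertexCoalgebra.{u, max u v} F,
        (FDGVertexCoalgebra.forget F).map (e.counitInv.app C)
            ≫ α.hom.app (e.inverse.obj C)
          = toDoubleDual.{u, v} C.space ≫ (gradedDual.{u, v} F).map (β.hom.app (op C)).op) :=
  ⟨dualityEquivalence.{u, v} F, Iso.refl _, Iso.refl _, isDualCoalgebra_dual.{u, v},
    isDualAlgebra_dual.{u, v}, fun _ => rfl, fun _ => rfl⟩

theorem mainTheorem2 (F : Type u) [Field F] [CharZero F] :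
    ∃ (e : (FDGVertexAlgebra.{u, max u v} F)ᵒᵖ ≌ FDGVertexCoalgebra.{u, max u v} F)
      (α : e.functor ⋙ FDGVertexCoalgebra.forget F
        ≅ (FDGVertexAlgebra.forget F).op ⋙ gradedDual.{u, v} F)
      (β : e.inverse.leftOp ⋙ FDGVertexAlgebra.forget F
        ≅ (FDGVertexCoalgebra.forget F).op ⋙ gradedDual.{u, v} F),
      (∀ A : FDGVertexAlgebra.{u, max u v} F,
        IsDualCoalgebra.{u, v} A (e.functor.obj (op A)) (α.app (op A))) ∧
      (∀ C : FDGVertexCoalgebra.{u, max u v} F,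
        IsDualAlgebra.{u, v} C (e.inverse.obj C).unop (β.app (op C))) ∧
      (∀ A : FDGVertexAlgebra.{u, max u v} F,
        (FDGVertexAlgebra.forget F).map (e.unitInv.app (op A)).unop
            ≫ β.hom.app (op (e.functor.obj (op A)))
          = toDoubleDual.{u, v} A.space ≫ (gradedDual.{u, v} F).map (α.hom.app (op A)).op) ∧
      (∀ C : FDGVertexCoalgebra.{u, max u v} F,
        (FDGVertexCoalgebra.forget F).map (e.counitInv.app C)
            ≫ α.hom.app (e.inverse.obj C)
          = toDoubleDual.{u, v} C.space ≫ (gradedDual.{u, v} F).map (β.hom.app (op C)).op) :=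
  mainTheorem2_general.{u, v} F
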